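/- Let $\mathbb W=(W_0,W_1)$ be a bi-isometry on a complex Hilbert space $\mathfrak K$, that is, a pair of commuting isometric operators on $\mathfrak K$. For $j\in\{0,1\}$, $\mathbb W$ is called $\{j\}$-pure if the only closed subspace $\mathfrak M$ of $\mathfrak K$ that reduces both $W_0$ and $W_1$ and for which $W_j|\mathfrak M$ is unitary on $\mathfrak M$ is $\mathfrak M=\{0\}$. Further notions: - Let $\mathfrak H=\bigoplus_{k\ge0}W_0^k(\mathfrak K\ominus W_0\mathfrak K)$ be the space of the shift part in the von Neumann-Wold decomposition of $W_0$, let $V_0=W_0|\mathfrak H$, $A=P_{\mathfrak H}W_1|\mathfrak H$ and $\mathfrak E=\mathfrak H\ominus V_0\mathfrak H$. The characteristic function of $\mathbb W$ is $\Theta_{\mathbb W}(z)=\sum_{k\ge0}z^kP_{\mathfrak E}V_0^{*k}A|\mathfrak E\in\mathcal L(\mathfrak E)$, $|z|<1$. - The pivotal operator of a bi-isometry $(W_0,W_1)$ is the operator on $\ker W_1^*$ whose adjoint is $W_0^*|\ker W_1^*$. The pivotal operator of $(W_1,W_0)$ is thus the operator on $\ker W_0^*$ whose adjoint is $W_1^*|\ker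 W_0^*$. - For a complex Hilbert space $\mathfrak F$, $H^2(\mathbb D^2)\otimes\mathfrak F$ is the Hilbert space of square summable power series $f(z_0,z_1)=\sum_{m,n\ge0}z_0^mz_1^nf_{m,n}$ with coefficients $f_{m,n}\in\mathfrak F$, and $\mathbb W_{\mathfrak F}$ is the bi-isometry on it that consists of the multiplications by $z_0$ and by $z_1$. Assume that $\mathbb W$ is both $\{0\}$-pure and $\{1\}$-pure. Then the following conditions are equivalent. 1. $\mathbb W$ is unitarily equivalent to $\mathbb W_{\mathfrak F}$ for some Hilbert space $\mathfrak F$ (that is, there is one unitary operator $U$ from $\mathfrak K$ onto $H^2(\mathbb D^2)\otimes\mathfrak F$ such that $UW_j$ equals multiplication by $z_j$ composed with $U$, for $j=0,1$). 2. $\mathbb W$ is doubly commuting, that is, $W_0W_1^*=W_1^*W_0$. 3. $\Theta_{\mathbb W}$ is a constant isometry, that is, there is an isometry $S\in\mathcal L(\mathfrak E)$ with $\Theta_{\mathbb W}(z)=S$ for all $|z|<1$. 4. The pivotal operator of $(W_1,W_0)$ is an isometry. 5. The pivotal operator of $\mathbb W=(W_0,W_1)$ is an isometry. -/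

import Mathlib

universe u

open scoped ENNReal

noncomputable section

/-! ### Families of operators, reducing subspaces, purity -/

/-- A linear subspace `M` reduces the family `V` if both `M` and its orthogonal complement are
invariant under every member of the family. -/
def IsReducing {ι K : Type*} [NormedAddCommGroup K] [InnerProductSpace ℂ K]
    (V : ι → K →L[ℂ] K) (M : Submodule ℂ K) : Prop :=
  ∀ i, (∀ x ∈ M, V i x ∈ M) ∧ (∀ x ∈ Mᗮ, V i x ∈ Mᗮ)

/-- The restriction of `T` to `M` is a unitary operator on `M`, that is, an isometry of `M`
onto `M`. -/
def IsUnitaryOn {K : Type*} [NormedAddCommGroup K] [InnerProductSpace ℂ K]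
    (T : K →L[ℂ] K) (M : Submodule ℂ K) : Prop :=
  (∀ x ∈ M, T x ∈ M) ∧ (∀ x ∈ M, ‖T x‖ = ‖x‖) ∧ (∀ y ∈ M, ∃ x ∈ M, T x = y)

/-- The family `V` is `J`-pure: it has no direct summand, acting on a nonzero space, on which all
`V j` with `j ∈ J` are unitary. -/
def IsPureFamily {ι K : Type*} [NormedAddCommGroup K] [InnerProductSpace ℂ K]
    (V : ι → K →L[ℂ] K) (J : Set ι) : Prop :=
  ∀ M : Submodule ℂ K, IsClosed (M : Set K) → IsReducing V M →
    (∀ j ∈ J, IsUnitaryOn (V j) M) → M = ⊥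

/-! ### Analytic function associated with a pair of operators -/

/-- The operator-valued power series `∑ z^k T_k`. -/
def operatorSeries {E : Type*} [NormedAddCommGroup E] [InnerProductSpace ℂ E]
    (T : ℕ → E →L[ℂ] E) (z : ℂ) : E →L[ℂ] E :=
  ∑' k : ℕ, z ^ k • T k

/-- If the coefficients are bounded, the series converges in operator norm on the unit disk. -/
theorem hasSum_operatorSeries {E : Type*} [NormedAddCommGroup E] [InnerProductSpace ℂ E]
    [CompleteSpace E] (T : ℕ → E →L[ℂ] E) {C : ℝ} (hT : ∀ k, ‖T k‖ ≤ C) {z : ℂ}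
    (hz : ‖z‖ < 1) : HasSum (fun k : ℕ => z ^ k • T k) (operatorSeries T z) := by
  have hg : Summable fun k : ℕ => ‖z‖ ^ k * C :=
    (summable_geometric_of_lt_one (norm_nonneg z) hz).mul_right _
  have hb : ∀ k : ℕ, ‖z ^ k • T k‖ ≤ ‖z‖ ^ k * C := by
    intro k
    rw [norm_smul, norm_pow]
    exact mul_le_mul_of_nonneg_left (hT k) (by positivity)
  exact (Summable.of_norm_bounded hg hb).hasSum

/-- The wandering subspace `H ⊖ V H` of an operator `V` on `H`. -/
def wanderingSpace {H : Type*} [NormedAddCommGroup H] [InnerProductSpace ℂ H]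
    (V : H →L[ℂ] H) : Submodule ℂ H :=
  V.rangeᗮ

instance wanderingSpace.completeSpace {H : Type*} [NormedAddCommGroup H] [InnerProductSpace ℂ H]
    [CompleteSpace H] (V : H →L[ℂ] H) : CompleteSpace (wanderingSpace V) := by
  unfold wanderingSpace
  infer_instance

/-- The coefficients `Θ_k = P_E V*^k A | E` of a pair `(V, A)`, where `E = H ⊖ V H`. -/
def pairCoeff {H : Type*} [NormedAddCommGroup H] [InnerProductSpace ℂ H] [CompleteSpace H]
    (V A : H →L[ℂ] H) (k : ℕ) : wanderingSpace V →L[ℂ] wanderingSpace V :=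
  (wanderingSpace V).orthogonalProjectionOnto ∘L
    (((ContinuousLinearMap.adjoint V) ^ k) ∘L A) ∘L (wanderingSpace V).subtypeL

/-- The operator-valued function `Θ(z) = ∑ z^k Θ_k` of a pair `(V, A)`, used for `|z| < 1`. -/
def pairFunction {H : Type*} [NormedAddCommGroup H] [InnerProductSpace ℂ H] [CompleteSpace H]
    (V A : H →L[ℂ] H) (z : ℂ) : wanderingSpace V →L[ℂ] wanderingSpace V :=
  operatorSeries (pairCoeff V A) z

theorem norm_pairCoeff_le {H : Type*} [NormedAddCommGroup H] [InnerProductSpace ℂ H]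
    [CompleteSpace H] (V A : H →L[ℂ] H) (hV : ‖V‖ ≤ 1) (k : ℕ) :
    ‖pairCoeff V A k‖ ≤ ‖A‖ := by
  have h1 : ∀ (n : ℕ) (y : H), ‖((ContinuousLinearMap.adjoint V) ^ n) y‖ ≤ ‖y‖ := by
    intro n
    induction n with
    | zero => intro y; simp
    | succ n ih =>
      intro y
      rw [pow_succ]
      change ‖((ContinuousLinearMap.adjoint V) ^ n) (ContinuousLinearMap.adjoint V y)‖ ≤ ‖y‖
      refine (ih _).trans ?_
      refine (ContinuousLinearMap.le_opNorm _ y).trans ?_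
      rw [LinearIsometryEquiv.norm_map]
      exact mul_le_of_le_one_left (norm_nonneg _) hV
  refine ContinuousLinearMap.opNorm_le_bound _ (norm_nonneg _) fun x => ?_
  refine ((wanderingSpace V).norm_orthogonalProjectionOnto_apply_le _).trans ?_
  refine (h1 k _).trans ?_
  exact A.le_opNorm (x : H)

/-! ### Bi-isometries -/

/-- A bi-isometry on `K`: a pair `(W_0, W_1)` of commuting isometric operators on `K`. -/
structure BiIsometry (K : Type*) [NormedAddCommGroup K] [InnerProductSpace ℂ K] where
  op : Fin 2 → K →L[ℂ] K
  norm_map : ∀ i x, ‖op i x‖ = ‖x‖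
  comm : ∀ i j x, op i (op j x) = op j (op i x)

namespace BiIsometry

/-- The bi-isometry `(W_1, W_0)`. -/
def swap {K : Type*} [NormedAddCommGroup K] [InnerProductSpace ℂ K] (W : BiIsometry K) :
    BiIsometry K where
  op := ![W.op 1, W.op 0]
  norm_map := by
    intro i x
    fin_cases i
    · exact W.norm_map 1 x
    · exact W.norm_map 0 x
  comm := by
    intro i j x
    fin_cases i <;> fin_cases j
    · rfl
    · exact W.comm 1 0 x
    · exact W.comm 0 1 x
    · rfl

/-- `J`-purity of a bi-isometry, for `J ⊆ {0, 1}`. -/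
def IsPure {K : Type*} [NormedAddCommGroup K] [InnerProductSpace ℂ K] (W : BiIsometry K)
    (J : Set (Fin 2)) : Prop :=
  IsPureFamily W.op J

/-- Unitary equivalence: one unitary operator intertwines both members of the pairs. -/
def UnitarilyEquivalent {K K' : Type*} [NormedAddCommGroup K] [InnerProductSpace ℂ K]
    [NormedAddCommGroup K'] [InnerProductSpace ℂ K'] (W : BiIsometry K) (W' : BiIsometry K') :
    Prop :=
  ∃ U : K ≃ₗᵢ[ℂ] K', ∀ i x, U (W.op i x) = W'.op i (U x)

/-- `W` is doubly commuting: `W_0 W_1* = W_1* W_0`. -/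
def DoublyCommuting {K : Type*} [NormedAddCommGroup K] [InnerProductSpace ℂ K] [CompleteSpace K]
    (W : BiIsometry K) : Prop :=
  W.op 0 ∘L ContinuousLinearMap.adjoint (W.op 1) =
    ContinuousLinearMap.adjoint (W.op 1) ∘L W.op 0

/-- The space `H` of the shift part in the von Neumann-Wold decomposition of `W_0`: the closed
linear span of the (mutually orthogonal) spaces `W_0^k (K ⊖ W_0 K)`. -/
def shiftSpace {K : Type*} [NormedAddCommGroup K] [InnerProductSpace ℂ K] (W : BiIsometry K) :
    Submodule ℂ K :=
  (⨆ k : ℕ, (wanderingSpace (W.op 0)).map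
    (((W.op 0) ^ k : K →L[ℂ] K) : K →ₗ[ℂ] K)).topologicalClosure

instance shiftSpace.completeSpace {K : Type*} [NormedAddCommGroup K] [InnerProductSpace ℂ K]
    [CompleteSpace K] (W : BiIsometry K) : CompleteSpace W.shiftSpace := by
  unfold shiftSpace
  infer_instance

theorem op_zero_mem_shiftSpace {K : Type*} [NormedAddCommGroup K] [InnerProductSpace ℂ K]
    (W : BiIsometry K) {x : K} (hx : x ∈ W.shiftSpace) : W.op 0 x ∈ W.shiftSpace := by
  have hle : (⨆ k : ℕ, (wanderingSpace (W.op 0)).map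
      (((W.op 0) ^ k : K →L[ℂ] K) : K →ₗ[ℂ] K)) ≤
      (⨆ k : ℕ, (wanderingSpace (W.op 0)).map
        (((W.op 0) ^ k : K →L[ℂ] K) : K →ₗ[ℂ] K)).comap (W.op 0 : K →ₗ[ℂ] K) := by
    refine iSup_le fun k => ?_
    rintro _ ⟨e, he, rfl⟩
    refine Submodule.mem_iSup_of_mem (k + 1) ⟨e, he, ?_⟩
    rw [pow_succ']
    rfl
  exact map_mem_closure (W.op 0).continuous hx fun y hy => hle hy

/-- First member of the characteristic pair: the unilateral shift `V_0 = W_0 | H`. -/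
def charShift {K : Type*} [NormedAddCommGroup K] [InnerProductSpace ℂ K]
    (W : BiIsometry K) : W.shiftSpace →L[ℂ] W.shiftSpace :=
  (W.op 0).restrict fun _ hx => W.op_zero_mem_shiftSpace hx

/-- Second member of the characteristic pair: the compression `A = P_H W_1 | H`. -/
def charContraction {K : Type*} [NormedAddCommGroup K] [InnerProductSpace ℂ K] [CompleteSpace K]
    (W : BiIsometry K) : W.shiftSpace →L[ℂ] W.shiftSpace :=
  W.shiftSpace.orthogonalProjectionOnto ∘L W.op 1 ∘L W.shiftSpace.subtypeL

/-- The characteristic function `Θ_W` of `W`, with values operators on `E = H ⊖ V_0 H`. -/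
def charFunction {K : Type*} [NormedAddCommGroup K] [InnerProductSpace ℂ K] [CompleteSpace K]
    (W : BiIsometry K) (z : ℂ) :
    wanderingSpace W.charShift →L[ℂ] wanderingSpace W.charShift :=
  pairFunction W.charShift W.charContraction z

theorem norm_charShift_le {K : Type*} [NormedAddCommGroup K] [InnerProductSpace ℂ K]
    (W : BiIsometry K) : ‖W.charShift‖ ≤ 1 := by
  refine ContinuousLinearMap.opNorm_le_bound _ zero_le_one fun x => ?_
  rw [one_mul]
  exact (W.norm_map 0 (x : K)).le

/-- The coefficients of the characteristic function are bounded, so that its power series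
converges on the unit disk. -/
theorem norm_charCoeff_le {K : Type*} [NormedAddCommGroup K] [InnerProductSpace ℂ K]
    [CompleteSpace K] (W : BiIsometry K) (k : ℕ) :
    ‖pairCoeff W.charShift W.charContraction k‖ ≤ ‖W.charContraction‖ :=
  norm_pairCoeff_le _ _ W.norm_charShift_le k

/-- `Θ_W` is a constant isometry on the unit disk. -/
def CharFunctionIsConstantIsometry {K : Type*} [NormedAddCommGroup K] [InnerProductSpace ℂ K]
    [CompleteSpace K] (W : BiIsometry K) : Prop :=
  ∃ S : wanderingSpace W.charShift →L[ℂ] wanderingSpace W.charShift,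
    Isometry S ∧ ∀ z : ℂ, ‖z‖ < 1 → W.charFunction z = S

theorem adjoint_mem_ker {K : Type*} [NormedAddCommGroup K] [InnerProductSpace ℂ K]
    [CompleteSpace K] (W : BiIsometry K) {x : K}
    (hx : x ∈ (ContinuousLinearMap.adjoint (W.op 1)).ker) :
    ContinuousLinearMap.adjoint (W.op 0) x ∈ (ContinuousLinearMap.adjoint (W.op 1)).ker := by
  have hx' : ContinuousLinearMap.adjoint (W.op 1) x = 0 := hx
  change ContinuousLinearMap.adjoint (W.op 1) (ContinuousLinearMap.adjoint (W.op 0) x) = 0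
  refine ext_inner_right ℂ fun y => ?_
  rw [ContinuousLinearMap.adjoint_inner_left, ContinuousLinearMap.adjoint_inner_left,
    W.comm 0 1 y, ← ContinuousLinearMap.adjoint_inner_left, hx', inner_zero_left,
    inner_zero_left]

/-- The pivotal operator of `(W_0, W_1)`: the operator on `ker W_1*` whose adjoint is
`W_0* | ker W_1*`. -/
def pivotalOperator {K : Type*} [NormedAddCommGroup K] [InnerProductSpace ℂ K] [CompleteSpace K]
    (W : BiIsometry K) :
    (ContinuousLinearMap.adjoint (W.op 1)).ker →L[ℂ] (ContinuousLinearMap.adjoint (W.op 1)).ker :=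
  ContinuousLinearMap.adjoint
    ((ContinuousLinearMap.adjoint (W.op 0)).restrict fun _ hx => W.adjoint_mem_ker hx)

end BiIsometry

/-! ### The Hardy space of the bidisk with coefficients in `F` -/

/-- The Hilbert space `H²(𝔻²) ⊗ F` of square summable power series
`f(z_0, z_1) = ∑ z_0^m z_1^n f_{m,n}` with coefficients `f_{m,n}` in `F`. -/
abbrev HardyBidisk (F : Type*) [NormedAddCommGroup F] : Type _ :=
  lp (fun _ : ℕ × ℕ => F) 2

namespace HardyBidisk

/-- The value at a point `z` of the bidisk of the function represented by `f`. -/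
def eval {F : Type*} [NormedAddCommGroup F] [InnerProductSpace ℂ F]
    (f : HardyBidisk F) (z : Fin 2 → ℂ) : F :=
  ∑' p : ℕ × ℕ, (z 0 ^ p.1 * z 1 ^ p.2) • f p

/-- The power series converges (absolutely) at every point of the bidisk. -/
theorem hasSum_eval {F : Type*} [NormedAddCommGroup F] [InnerProductSpace ℂ F] [CompleteSpace F]
    (f : HardyBidisk F) {z : Fin 2 → ℂ} (hz : ∀ i, ‖z i‖ < 1) :
    HasSum (fun p : ℕ × ℕ => (z 0 ^ p.1 * z 1 ^ p.2) • f p) (eval f z) := by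
  refine Summable.hasSum ?_
  have hg : Summable fun p : ℕ × ℕ => ‖z 0‖ ^ p.1 * ‖z 1‖ ^ p.2 :=
    (summable_geometric_of_lt_one (norm_nonneg _) (hz 0)).mul_of_nonneg
      (summable_geometric_of_lt_one (norm_nonneg _) (hz 1))
      (fun _ => by positivity) (fun _ => by positivity)
  refine Summable.of_norm_bounded (hg.mul_right ‖f‖) fun p => ?_
  rw [norm_smul, norm_mul, norm_pow, norm_pow]
  exact mul_le_mul_of_nonneg_left (lp.norm_apply_le_norm two_ne_zero f p) (by positivity)

/-- Raising the exponent of `z_i` by one. -/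
def raise (i : Fin 2) (p : ℕ × ℕ) : ℕ × ℕ :=
  if i = 0 then (p.1 + 1, p.2) else (p.1, p.2 + 1)

theorem raise_injective (i : Fin 2) : Function.Injective (raise i) := by
  rintro ⟨a, b⟩ ⟨c, d⟩ h
  unfold raise at h
  split_ifs at h <;> simp_all

theorem hasSum_extend_raise {F : Type*} [NormedAddCommGroup F] (i : Fin 2) (f : HardyBidisk F) :
    HasSum (fun p => ‖Function.extend (raise i) f 0 p‖ ^ (2 : ℝ≥0∞).toReal)
      (‖f‖ ^ (2 : ℝ≥0∞).toReal) := by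
  have h2 : 0 < (2 : ℝ≥0∞).toReal := by simp
  rw [← (raise_injective i).hasSum_iff]
  · have := lp.hasSum_norm h2 f
    refine this.congr_fun ?_
    intro p
    simp [(raise_injective i).extend_apply]
  · intro p hp
    rw [Function.extend_apply' _ _ _ (fun ⟨q, hq⟩ => hp ⟨q, hq⟩)]
    simp

/-- Multiplication by the coordinate `z_i`: the coefficients are moved along `raise i`, and the
coefficients of monomials not divisible by `z_i` vanish. -/
def mulCoord {F : Type*} [NormedAddCommGroup F] [InnerProductSpace ℂ F] (i : Fin 2) :
    HardyBidisk F →ₗᵢ[ℂ] HardyBidisk F where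
  toFun f := ⟨Function.extend (raise i) f 0, memℓp_gen (hasSum_extend_raise i f).summable⟩
  map_add' f g := by
    ext p
    change Function.extend (raise i) (⇑(f + g)) 0 p =
      Function.extend (raise i) (⇑f) 0 p + Function.extend (raise i) (⇑g) 0 p
    by_cases hp : ∃ q, raise i q = p
    · obtain ⟨q, rfl⟩ := hp
      rw [(raise_injective i).extend_apply, (raise_injective i).extend_apply,
        (raise_injective i).extend_apply]
      rfl
    · rw [Function.extend_apply' _ _ _ hp, Function.extend_apply' _ _ _ hp,
        Function.extend_apply' _ _ _ hp]
      simp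
  map_smul' c f := by
    ext p
    change Function.extend (raise i) (⇑(c • f)) 0 p =
      c • Function.extend (raise i) (⇑f) 0 p
    by_cases hp : ∃ q, raise i q = p
    · obtain ⟨q, rfl⟩ := hp
      simp [(raise_injective i).extend_apply]
    · simp [Function.extend_apply' _ _ _ hp]
  norm_map' f := by
    have h2 : 0 < (2 : ℝ≥0∞).toReal := by simp
    have h := (hasSum_extend_raise i f).tsum_eq
    have h' := lp.norm_rpow_eq_tsum h2
      (⟨Function.extend (raise i) f 0, memℓp_gen (hasSum_extend_raise i f).summable⟩ :
        HardyBidisk F)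
    exact (Real.rpow_left_inj (norm_nonneg _) (norm_nonneg _) h2.ne').mp (h'.trans h)

theorem mulCoord_raise {F : Type*} [NormedAddCommGroup F] [InnerProductSpace ℂ F] (i : Fin 2)
    (f : HardyBidisk F) (p : ℕ × ℕ) : mulCoord i f (raise i p) = f p :=
  (raise_injective i).extend_apply _ _ _

theorem mulCoord_of_not_range {F : Type*} [NormedAddCommGroup F] [InnerProductSpace ℂ F]
    (i : Fin 2) (f : HardyBidisk F) (p : ℕ × ℕ) (hp : ¬ ∃ q, raise i q = p) :
    mulCoord i f p = 0 :=
  Function.extend_apply' _ _ _ hp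

/-- On the bidisk, `mulCoord i` is pointwise multiplication: `(W_i f)(z) = z_i f(z)`. -/
theorem eval_mulCoord {F : Type*} [NormedAddCommGroup F] [InnerProductSpace ℂ F] [CompleteSpace F]
    (i : Fin 2) (f : HardyBidisk F) {z : Fin 2 → ℂ} (hz : ∀ i, ‖z i‖ < 1) :
    eval (mulCoord i f) z = z i • eval f z := by
  refine HasSum.unique (hasSum_eval _ hz) ?_
  rw [← (raise_injective i).hasSum_iff]
  · refine ((hasSum_eval f hz).const_smul (z i)).congr_fun ?_
    intro p
    simp only [Function.comp, mulCoord_raise, smul_smul]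
    congr 1
    fin_cases i <;> simp [raise] <;> ring
  · intro p hp
    rw [mulCoord_of_not_range i f p (fun ⟨q, hq⟩ => hp ⟨q, hq⟩), smul_zero]

theorem mulCoord_comm {F : Type*} [NormedAddCommGroup F] [InnerProductSpace ℂ F]
    (f : HardyBidisk F) : mulCoord 0 (mulCoord 1 f) = mulCoord 1 (mulCoord 0 f) := by
  ext p
  obtain ⟨m, n⟩ := p
  rcases m with _ | m
  · rw [mulCoord_of_not_range 0 _ _ (by simp [raise])]
    rcases n with _ | n
    · rw [mulCoord_of_not_range 1 _ _ (by simp [raise])]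
    · rw [show ((0 : ℕ), n + 1) = raise 1 (0, n) from rfl, mulCoord_raise,
        mulCoord_of_not_range 0 _ _ (by simp [raise])]
  · rw [show (m + 1, n) = raise 0 (m, n) from rfl, mulCoord_raise]
    rcases n with _ | n
    · rw [mulCoord_of_not_range 1 _ _ (by simp [raise]),
        mulCoord_of_not_range 1 _ _ (by simp [raise])]
    · rw [show (m, n + 1) = raise 1 (m, n) from rfl, mulCoord_raise,
        show raise 0 (raise 1 (m, n)) = raise 1 (raise 0 (m, n)) from rfl, mulCoord_raise,
        mulCoord_raise]

/-- The bi-isometry `W_F` of multiplications by the coordinates on `H²(𝔻²) ⊗ F`. -/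
def coordBiIsometry (F : Type*) [NormedAddCommGroup F] [InnerProductSpace ℂ F] :
    BiIsometry (HardyBidisk F) where
  op i := (mulCoord i).toContinuousLinearMap
  norm_map i f := (mulCoord i).norm_map f
  comm i j f := by
    change mulCoord i (mulCoord j f) = mulCoord j (mulCoord i f)
    fin_cases i <;> fin_cases j
    · rfl
    · exact mulCoord_comm f
    · exact (mulCoord_comm f).symm
    · rfl

end HardyBidisk

end

open scoped InnerProductSpace
open ContinuousLinearMap (adjoint)

/-! ### Isometric operators -/

/-! Conditions 2 to 5 all say that one wandering subspace is invariant under the other isometry.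
Double commutation means `W_0 (ker W_1*) ⊆ ker W_1*`, because `1 - W_1 W_1*` projects onto `ker
W_1*`; taking adjoints exchanges the indices. The pivotal operator is the compression of `W_0` to
`ker W_1*`, and a compression of an isometry preserves norms exactly when the subspace is invariant.
For `Θ_W`, vanishing of the higher coefficients puts `A e` in `E = ker W_0*`, and isometry of the
constant term forces `A e = W_1 e`.

Purity gives the model. Under double commutation the unitary part of `W_i` reduces both operators,
so purity removes it and each `W_i` is a shift. With `L = ker W_0* ∩ ker W_1*`, the spaces `W_0^m
W_1^n L` are mutually orthogonal (`DoublyCommuting.orthogonalFamily`) and total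
(`DoublyCommuting.isHilbertSum`), which identifies `K` with the square summable families in `L`
indexed by `ℕ × ℕ`. Conversely, in the model forward and backward shifts in different variables
commute. -/

theorem adjoint_apply_of_norm_map {K : Type*} [NormedAddCommGroup K] [InnerProductSpace ℂ K]
    [CompleteSpace K] {T : K →L[ℂ] K} (hT : ∀ x, ‖T x‖ = ‖x‖) (x : K) : adjoint T (T x) = x :=
  congr($(T.norm_map_iff_adjoint_comp_self.mp hT) x)

theorem norm_pow_apply_of_norm_map {K : Type*} [NormedAddCommGroup K] [InnerProductSpace ℂ K]
    {T : K →L[ℂ] K} (hT : ∀ x, ‖T x‖ = ‖x‖) (n : ℕ) (x : K) : ‖(T ^ n) x‖ = ‖x‖ := by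
  induction n with
  | zero => simp
  | succ n ih => rw [pow_succ']; exact (hT _).trans ih

theorem inner_pow_apply_of_norm_map {K : Type*} [NormedAddCommGroup K] [InnerProductSpace ℂ K]
    {T : K →L[ℂ] K} (hT : ∀ x, ‖T x‖ = ‖x‖) (n : ℕ) (x y : K) :
    ⟪(T ^ n) x, (T ^ n) y⟫_ℂ = ⟪x, y⟫_ℂ :=
  (LinearMap.norm_map_iff_inner_map_map (T ^ n)).mp (norm_pow_apply_of_norm_map hT n) x y

theorem inner_adjoint_pow_right {K : Type*} [NormedAddCommGroup K] [InnerProductSpace ℂ K]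
    [CompleteSpace K] (T : K →L[ℂ] K) (n : ℕ) (x y : K) :
    ⟪x, ((adjoint T) ^ n) y⟫_ℂ = ⟪(T ^ n) x, y⟫_ℂ := by
  induction n generalizing x y with
  | zero => simp
  | succ n ih =>
    rw [pow_succ, pow_succ']
    change ⟪x, ((adjoint T) ^ n) (adjoint T y)⟫_ℂ = ⟪T ((T ^ n) x), y⟫_ℂ
    rw [ih, ContinuousLinearMap.adjoint_inner_right]

theorem inner_pow_pow_add_eq_zero {K : Type*} [NormedAddCommGroup K] [InnerProductSpace ℂ K]
    [CompleteSpace K] {T : K →L[ℂ] K} (hT : ∀ x, ‖T x‖ = ‖x‖) (m k : ℕ) {x : K} (hx : adjoint T x = 0)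
    (y : K) : ⟪(T ^ m) x, (T ^ (m + (k + 1))) y⟫_ℂ = 0 := by
  rw [pow_add, mul_apply_eq_comp, inner_pow_apply_of_norm_map hT, pow_succ',
    mul_apply_eq_comp, ← ContinuousLinearMap.adjoint_inner_left, hx, inner_zero_left]

theorem inner_pow_pow_eq_zero {K : Type*} [NormedAddCommGroup K] [InnerProductSpace ℂ K]
    [CompleteSpace K] {T : K →L[ℂ] K} (hT : ∀ x, ‖T x‖ = ‖x‖) {m n : ℕ} (hmn : m ≠ n) {x y : K}
    (hx : adjoint T x = 0) (hy : adjoint T y = 0) : ⟪(T ^ m) x, (T ^ n) y⟫_ℂ = 0 := by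
  rcases lt_or_gt_of_ne hmn with h | h
  · obtain ⟨k, rfl⟩ := Nat.exists_eq_add_of_lt h
    exact inner_pow_pow_add_eq_zero hT m k hx y
  · obtain ⟨k, rfl⟩ := Nat.exists_eq_add_of_lt h
    exact inner_eq_zero_symm.mp (inner_pow_pow_add_eq_zero hT n k hy x)

theorem mem_wanderingSpace_iff {H : Type*} [NormedAddCommGroup H] [InnerProductSpace ℂ H]
    [CompleteSpace H] {V : H →L[ℂ] H} {x : H} : x ∈ wanderingSpace V ↔ adjoint V x = 0 := by
  rw [wanderingSpace, ContinuousLinearMap.orthogonal_range]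
  rfl

/-! ### Uniqueness of the coefficients of operator-valued power series -/

/-- Both families are power series expansions of `f` at the origin, and such an expansion is unique.
-/
theorem coeff_eq_of_hasSum_pow_smul {E : Type*} [NormedAddCommGroup E] [NormedSpace ℂ E]
    {a b : ℕ → E} {f : ℂ → E} (ha : ∀ z : ℂ, ‖z‖ < 1 → HasSum (fun k => z ^ k • a k) (f z))
    (hb : ∀ z : ℂ, ‖z‖ < 1 → HasSum (fun k => z ^ k • b k) (f z)) : a = b := by
  have key : ∀ c : ℕ → E, (∀ z : ℂ, ‖z‖ < 1 → HasSum (fun k => z ^ k • c k) (f z)) →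
      HasFPowerSeriesAt f (show FormalMultilinearSeries ℂ ℂ E from
        fun n => ContinuousMultilinearMap.mkPiRing ℂ (Fin n) (c n)) 0 := by
    intro c hc
    rw [hasFPowerSeriesAt_iff]
    filter_upwards [Metric.ball_mem_nhds (0 : ℂ) one_pos] with z hz
    rw [zero_add]
    simpa [FormalMultilinearSeries.coeff] using hc z (by simpa using hz)
  have h := (key a ha).eq_formalMultilinearSeries (key b hb)
  funext n
  have := congr($h n (fun _ => 1))
  simpa using this

/-- The bound on `T` guarantees convergence; a bare `tsum` would not determine the coefficients. -/
theorem operatorSeries_eq_const_iff {E : Type*} [NormedAddCommGroup E] [InnerProductSpace ℂ E]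
    [CompleteSpace E] {T : ℕ → E →L[ℂ] E} {C : ℝ} (hT : ∀ k, ‖T k‖ ≤ C) {S : E →L[ℂ] E} :
    (∀ z : ℂ, ‖z‖ < 1 → operatorSeries T z = S) ↔ T = Pi.single 0 S := by
  have hS : ∀ z : ℂ, HasSum (fun k => z ^ k • (Pi.single 0 S : ℕ → E →L[ℂ] E) k) S := by
    intro z
    convert hasSum_single (f := fun k => z ^ k • (Pi.single 0 S : ℕ → E →L[ℂ] E) k) 0 ?_
    · simp
    · intro k hk
      simp [hk]
  constructor
  · intro h
    refine coeff_eq_of_hasSum_pow_smul (f := fun _ => S) (fun z hz => ?_) fun z _ => hS z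
    rw [← h z hz]
    exact hasSum_operatorSeries T hT hz
  · rintro rfl z -
    exact (hS z).tsum_eq

namespace BiIsometry

/-! ### Double commutation -/

section

variable {K : Type*} [NormedAddCommGroup K] [InnerProductSpace ℂ K] [CompleteSpace K]
  {W : BiIsometry K}

theorem adjoint_op_op (W : BiIsometry K) (i : Fin 2) (x : K) : (adjoint (W.op i)) (W.op i x) = x :=
  adjoint_apply_of_norm_map (W.norm_map i) x

omit [CompleteSpace K] in
theorem comm_pow (W : BiIsometry K) (i j : Fin 2) (n : ℕ) (x : K) :
    W.op i ((W.op j ^ n) x) = (W.op j ^ n) (W.op i x) :=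
  congr($((show Commute (W.op i) (W.op j) from
    ContinuousLinearMap.ext (W.comm i j)).pow_right n) x)

theorem doublyCommuting_iff :
    W.DoublyCommuting ↔ ∀ x, (adjoint (W.op 1)) x = 0 → (adjoint (W.op 1)) (W.op 0 x) = 0 := by
  constructor
  · intro h x hx
    have := congr($h x)
    simp only [ContinuousLinearMap.comp_apply, hx, map_zero] at this
    exact this.symm
  · intro h
    ext x
    -- This is the projection of `x` onto `ker W_1*`; expanding `W_1* W_0` of it leaves exactly the
    -- commutator of `W_0` and `W_1*` at `x`.
    have h1 := h (x - W.op 1 (adjoint (W.op 1) x)) (by rw [map_sub, adjoint_op_op, sub_self])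
    rw [map_sub, map_sub, W.comm 0 1, adjoint_op_op, sub_eq_zero] at h1
    exact h1.symm

theorem DoublyCommuting.op_adjoint (h : W.DoublyCommuting) {i j : Fin 2} (hij : i ≠ j) (x : K) :
    W.op i ((adjoint (W.op j)) x) = (adjoint (W.op j)) (W.op i x) := by
  have h' : W.op 1 ∘L (adjoint (W.op 0)) = (adjoint (W.op 0)) ∘L W.op 1 := by
    have := congr(adjoint $h)
    rw [ContinuousLinearMap.adjoint_comp, ContinuousLinearMap.adjoint_comp,
      ContinuousLinearMap.adjoint_adjoint] at this
    exact this
  fin_cases i <;> fin_cases j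
  · exact absurd rfl hij
  · exact congr($h x)
  · exact congr($h' x)
  · exact absurd rfl hij

theorem DoublyCommuting.op_pow_adjoint (h : W.DoublyCommuting) {i j : Fin 2} (hij : i ≠ j)
    (n : ℕ) (x : K) : (W.op i ^ n) ((adjoint (W.op j)) x) = (adjoint (W.op j)) ((W.op i ^ n) x) :=
  congr($((show Commute (adjoint (W.op j)) (W.op i) from
    ContinuousLinearMap.ext fun y => (h.op_adjoint hij y).symm).pow_right n) x).symm

theorem doublyCommuting_swap_iff : W.swap.DoublyCommuting ↔ W.DoublyCommuting := by
  constructor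
  · intro h
    exact ContinuousLinearMap.ext (h.op_adjoint (i := 1) (j := 0) (by decide))
  · intro h
    exact ContinuousLinearMap.ext (h.op_adjoint (i := 1) (j := 0) (by decide))

/-! ### The pivotal operator -/

/-- Taking the adjoint of a restriction produces a compression. -/
theorem coe_pivotalOperator (W : BiIsometry K) (x : (adjoint (W.op 1)).ker) :
    (W.pivotalOperator x : K) = (adjoint (W.op 1)).ker.starProjection (W.op 0 x) := by
  symm
  refine Submodule.eq_starProjection_of_mem_of_inner_eq_zero (Subtype.mem _) fun y hy => ?_
  have h := ContinuousLinearMap.adjoint_inner_left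
    ((adjoint (W.op 0)).restrict fun _ hx => W.adjoint_mem_ker hx) ⟨y, hy⟩ x
  have h2 : ⟪(W.pivotalOperator x : K), y⟫_ℂ = ⟪(x : K), (adjoint (W.op 0)) y⟫_ℂ := h
  rw [inner_sub_left, h2, ContinuousLinearMap.adjoint_inner_right, sub_self]

/-- A projection preserves the norm of a vector only if the vector lies in its range, here `W_0 x`
in `ker W_1*`. -/
theorem isometry_pivotalOperator_iff : Isometry W.pivotalOperator ↔ W.DoublyCommuting := by
  rw [AddMonoidHomClass.isometry_iff_norm, doublyCommuting_iff, Subtype.forall]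
  refine forall₂_congr fun x hx => ?_
  rw [Submodule.coe_norm, coe_pivotalOperator, Submodule.coe_norm, ← W.norm_map 0 (Subtype.val _)]
  exact (Submodule.mem_iff_norm_starProjection (adjoint (W.op 1)).ker (W.op 0 x)).symm

/-! ### The characteristic function -/

theorem pow_mem_shiftSpace (W : BiIsometry K) (n : ℕ) {x : K} (hx : (adjoint (W.op 0)) x = 0) :
    (W.op 0 ^ n) x ∈ W.shiftSpace :=
  Submodule.le_topologicalClosure _
    (Submodule.mem_iSup_of_mem n ⟨x, mem_wanderingSpace_iff.mpr hx, rfl⟩)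

theorem mem_shiftSpace (W : BiIsometry K) {x : K} (hx : (adjoint (W.op 0)) x = 0) :
    x ∈ W.shiftSpace := by
  simpa using W.pow_mem_shiftSpace 0 hx

theorem eq_zero_of_mem_shiftSpace (W : BiIsometry K) {x : K} (hx : x ∈ W.shiftSpace)
    (h : ∀ (n : ℕ) (y : K), (adjoint (W.op 0)) y = 0 → ⟪(W.op 0 ^ n) y, x⟫_ℂ = 0) : x = 0 := by
  have hle : W.shiftSpace ≤ (Submodule.span ℂ {x})ᗮ := by
    refine Submodule.topologicalClosure_minimal _ (iSup_le fun n => ?_)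
      (Submodule.isClosed_orthogonal _)
    rintro _ ⟨y, hy, rfl⟩
    rw [Submodule.mem_orthogonal_singleton_iff_inner_left]
    exact h n y (mem_wanderingSpace_iff.mp hy)
  exact inner_self_eq_zero.mp (Submodule.mem_orthogonal_singleton_iff_inner_left.mp (hle hx))

/-- `W_0*` lowers the power in `W_0^k y` by one and kills the term `k = 0`. Thus the shift space
reduces `W_0`, and the adjoint of `V_0` is a restriction of `W_0*`. -/
theorem adjoint_mem_shiftSpace (W : BiIsometry K) {x : K} (hx : x ∈ W.shiftSpace) :
    (adjoint (W.op 0)) x ∈ W.shiftSpace := by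
  have hle : (⨆ k : ℕ, (wanderingSpace (W.op 0)).map
      (((W.op 0) ^ k : K →L[ℂ] K) : K →ₗ[ℂ] K)) ≤
      W.shiftSpace.comap (adjoint (W.op 0) : K →ₗ[ℂ] K) := by
    refine iSup_le fun k => ?_
    rintro _ ⟨y, hy, rfl⟩
    have hy' := mem_wanderingSpace_iff.mp hy
    change (adjoint (W.op 0)) ((W.op 0 ^ k) y) ∈ W.shiftSpace
    cases k with
    | zero => simp [hy']
    | succ k =>
      rw [pow_succ', mul_apply_eq_comp, adjoint_op_op]
      exact W.pow_mem_shiftSpace k hy'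
  exact Submodule.topologicalClosure_minimal _ hle
    ((Submodule.isClosed_topologicalClosure _).preimage (adjoint (W.op 0)).continuous) hx

theorem coe_adjoint_charShift (W : BiIsometry K) (x : W.shiftSpace) :
    (((adjoint W.charShift) x : W.shiftSpace) : K) = (adjoint (W.op 0)) x := by
  have : (adjoint W.charShift) x = ⟨(adjoint (W.op 0)) x, W.adjoint_mem_shiftSpace x.2⟩ := by
    refine ext_inner_right ℂ fun y => ?_
    rw [ContinuousLinearMap.adjoint_inner_left]
    exact (ContinuousLinearMap.adjoint_inner_left (W.op 0) (y : K) x).symm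
  rw [this]

theorem mem_wanderingSpace_charShift_iff {x : W.shiftSpace} :
    x ∈ wanderingSpace W.charShift ↔ (adjoint (W.op 0)) (x : K) = 0 := by
  rw [mem_wanderingSpace_iff, ← coe_adjoint_charShift, Submodule.coe_eq_zero]

omit [CompleteSpace K] in
theorem coe_pow_charShift (W : BiIsometry K) (n : ℕ) (x : W.shiftSpace) :
    (((W.charShift ^ n) x : W.shiftSpace) : K) = (W.op 0 ^ n) x := by
  induction n with
  | zero => simp
  | succ n ih =>
    rw [pow_succ', pow_succ', mul_apply_eq_comp, mul_apply_eq_comp, ← ih]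
    rfl

/-- A vector of the shift space is determined by the components `P_E V_0*^k x`. -/
theorem eq_zero_of_forall_orthogonalProjectionOnto_eq_zero (W : BiIsometry K) {x : W.shiftSpace}
    (h : ∀ n : ℕ, (wanderingSpace W.charShift).orthogonalProjectionOnto
      (((adjoint W.charShift) ^ n) x) = 0) : x = 0 := by
  refine Subtype.ext (W.eq_zero_of_mem_shiftSpace x.2 fun n y hy => ?_)
  have hy' : (⟨y, W.mem_shiftSpace hy⟩ : W.shiftSpace) ∈ wanderingSpace W.charShift :=
    mem_wanderingSpace_charShift_iff.mpr hy
  have h2 := Submodule.orthogonalProjectionOnto_eq_zero_iff.mp (h n) _ hy'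
  rw [inner_adjoint_pow_right] at h2
  rw [← W.coe_pow_charShift n ⟨y, W.mem_shiftSpace hy⟩]
  exact h2

theorem charFunctionIsConstantIsometry_iff :
    W.CharFunctionIsConstantIsometry ↔ ∀ x, (adjoint (W.op 0)) x = 0 → (adjoint (W.op 0)) (W.op 1 x) = 0 := by
  have hconst : ∀ S, (∀ z : ℂ, ‖z‖ < 1 → W.charFunction z = S) ↔
      pairCoeff W.charShift W.charContraction = Pi.single 0 S :=
    fun S => operatorSeries_eq_const_iff W.norm_charCoeff_le
  have hcoe : ∀ y : W.shiftSpace,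
      (W.charContraction y : K) = W.shiftSpace.starProjection (W.op 1 y) := fun y => rfl
  constructor
  · rintro ⟨S, hS, hW⟩ x hx
    rw [hconst] at hW
    have hxE : (⟨x, W.mem_shiftSpace hx⟩ : W.shiftSpace) ∈ wanderingSpace W.charShift :=
      mem_wanderingSpace_charShift_iff.mpr hx
    set e : wanderingSpace W.charShift := ⟨⟨x, W.mem_shiftSpace hx⟩, hxE⟩
    -- The components `P_E V_0*^n` of `V_0* A e` are the coefficients of index `n + 1` at `e`, all
    -- zero, so `V_0* A e = 0`.
    have hA : W.charContraction e ∈ wanderingSpace W.charShift := by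
      rw [mem_wanderingSpace_iff]
      refine W.eq_zero_of_forall_orthogonalProjectionOnto_eq_zero fun n => ?_
      have h := congr($hW (n + 1) e)
      rw [Pi.single_eq_of_ne (Nat.succ_ne_zero n)] at h
      rw [← mul_apply_eq_comp, ← pow_succ]
      exact h
    have hSe : ((S e : wanderingSpace W.charShift) : W.shiftSpace) = W.charContraction e := by
      have h : (wanderingSpace W.charShift).orthogonalProjectionOnto (W.charContraction e) = S e := by
        have h := congr($hW 0 e)
        rwa [Pi.single_eq_same] at h
      rw [← h]
      exact Submodule.starProjection_eq_self_iff.mpr hA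
    -- Since `S e = P_H W_1 x` has the full norm of `W_1 x`, the vector `W_1 x` already lies in the
    -- shift space.
    have hnorm : ‖W.shiftSpace.starProjection (W.op 1 x)‖ = ‖W.op 1 x‖ := by
      have h := (AddMonoidHomClass.isometry_iff_norm S).mp hS e
      rw [Submodule.coe_norm, hSe] at h
      rw [W.norm_map 1]
      exact h
    have hmem := (Submodule.mem_iff_norm_starProjection _ _).mpr hnorm
    rw [mem_wanderingSpace_charShift_iff, hcoe, Submodule.starProjection_eq_self_iff.mpr hmem] at hA
    exact hA
  · intro h
    -- Here `W_1 e` lies in `ker W_0*`, hence in the shift space, so the projection in `A` acts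
    -- trivially.
    have hA : ∀ e : wanderingSpace W.charShift,
        (W.charContraction e : K) = W.op 1 (e : W.shiftSpace) ∧
          W.charContraction e ∈ wanderingSpace W.charShift := by
      intro e
      have h0 := h _ (mem_wanderingSpace_charShift_iff.mp e.2)
      have h1 : (W.charContraction e : K) = W.op 1 (e : W.shiftSpace) := by
        rw [hcoe]
        exact Submodule.starProjection_eq_self_iff.mpr (W.mem_shiftSpace h0)
      exact ⟨h1, mem_wanderingSpace_charShift_iff.mpr (by rw [h1]; exact h0)⟩
    have h0 : ∀ e, ((pairCoeff W.charShift W.charContraction 0 e :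
        wanderingSpace W.charShift) : W.shiftSpace) = W.charContraction e := fun e =>
      Submodule.starProjection_eq_self_iff.mpr (hA e).2
    refine ⟨pairCoeff W.charShift W.charContraction 0, ?_, (hconst _).mpr ?_⟩
    · refine (AddMonoidHomClass.isometry_iff_norm _).mpr fun e => ?_
      rw [Submodule.coe_norm, h0, Submodule.coe_norm, (hA e).1, W.norm_map]
      rfl
    · funext n
      cases n with
      | zero => rw [Pi.single_eq_same]
      | succ n =>
        rw [Pi.single_eq_of_ne (Nat.succ_ne_zero n)]
        ext1 e
        change (wanderingSpace W.charShift).orthogonalProjectionOnto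
          (((adjoint W.charShift) ^ (n + 1)) (W.charContraction e)) = 0
        rw [pow_succ, mul_apply_eq_comp, mem_wanderingSpace_iff.mp (hA e).2, map_zero,
          map_zero]

/-! ### Doubly commuting pure bi-isometries -/

/-- If `W` is doubly commuting and `{i}`-pure, then `W_i` is a unilateral shift: its wandering
subspace generates the space. -/
theorem DoublyCommuting.eq_zero_of_orthogonal (h : W.DoublyCommuting) {i : Fin 2}
    (hpure : W.IsPure {i}) {x : K}
    (hx : ∀ (n : ℕ) (y : K), (adjoint (W.op i)) y = 0 → ⟪(W.op i ^ n) y, x⟫_ℂ = 0) : x = 0 := by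
  -- The unitary part of `W_i` in its Wold decomposition. It is to be shown that it reduces both
  -- operators.
  set M : Submodule ℂ K :=
    (⨆ n : ℕ, (adjoint (W.op i)).ker.map ((W.op i ^ n : K →L[ℂ] K) : K →ₗ[ℂ] K))ᗮ with hM
  have mem_iff : ∀ z, z ∈ M ↔ ∀ (n : ℕ) (y : K), (adjoint (W.op i)) y = 0 → ⟪(W.op i ^ n) y, z⟫_ℂ = 0 := by
    intro z
    rw [hM, ← Submodule.iInf_orthogonal, Submodule.mem_iInf]
    refine forall_congr' fun n => ?_
    rw [Submodule.mem_orthogonal]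
    exact ⟨fun hz y hy => hz _ ⟨y, hy, rfl⟩, by rintro hz _ ⟨y, hy, rfl⟩; exact hz y hy⟩
  have op_mem : ∀ j, ∀ z ∈ M, W.op j z ∈ M := by
    intro j z hz
    rw [mem_iff] at hz ⊢
    intro n y hy
    by_cases hij : i = j
    · subst hij
      cases n with
      | zero => simp [← ContinuousLinearMap.adjoint_inner_left, hy]
      | succ n =>
        rw [← ContinuousLinearMap.adjoint_inner_left, pow_succ', mul_apply_eq_comp,
          adjoint_op_op]
        exact hz n y hy
    -- Double commutation moves `W_j*` past `W_i^n`; it then preserves `ker W_i*` by plain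
    -- commutation of the adjoints.
    · rw [← ContinuousLinearMap.adjoint_inner_left, ← h.op_pow_adjoint hij]
      refine hz n _ ?_
      refine ext_inner_right ℂ fun w => ?_
      rw [ContinuousLinearMap.adjoint_inner_left, ContinuousLinearMap.adjoint_inner_left,
        W.comm j i, ← ContinuousLinearMap.adjoint_inner_left, hy, inner_zero_left,
        inner_zero_left]
  have adjoint_mem : ∀ j, ∀ z ∈ M, (adjoint (W.op j)) z ∈ M := by
    intro j z hz
    rw [mem_iff] at hz ⊢
    intro n y hy
    rw [ContinuousLinearMap.adjoint_inner_right]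
    by_cases hij : i = j
    · subst hij
      rw [← mul_apply_eq_comp, ← pow_succ']
      exact hz (n + 1) y hy
    · rw [comm_pow]
      exact hz n _ (by rw [← h.op_adjoint (Ne.symm hij), hy, map_zero])
  have hbot : M = ⊥ := by
    refine hpure M (Submodule.isClosed_orthogonal _) (fun j => ⟨op_mem j, fun z hz => ?_⟩) ?_
    · rw [Submodule.mem_orthogonal] at hz ⊢
      intro u hu
      rw [← ContinuousLinearMap.adjoint_inner_left]
      exact hz _ (adjoint_mem j u hu)
    · intro j hj
      rw [Set.mem_singleton_iff.mp hj]
      refine ⟨op_mem _, fun z _ => W.norm_map _ z, fun z hz => ⟨_, adjoint_mem i z hz, ?_⟩⟩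
      -- The defect `z - W_i W_i* z` lies both in `M` and in `ker W_i*`, so the condition at `n = 0`
      -- makes it orthogonal to itself.
      have hker : (adjoint (W.op i)) (z - W.op i ((adjoint (W.op i)) z)) = 0 := by
        rw [map_sub, adjoint_op_op, sub_self]
      have hmem : z - W.op i ((adjoint (W.op i)) z) ∈ M :=
        M.sub_mem hz (op_mem _ _ (adjoint_mem _ z hz))
      have := (mem_iff _).mp hmem 0 _ hker
      exact (sub_eq_zero.mp (inner_self_eq_zero.mp this)).symm
  have hxM : x ∈ M := (mem_iff x).mpr hx
  rwa [hbot, Submodule.mem_bot] at hxM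

/-- The joint wandering subspace `ker W_0* ∩ ker W_1*`. -/
noncomputable def jointWanderingSpace (W : BiIsometry K) : Submodule ℂ K :=
  (adjoint (W.op 0)).ker ⊓ (adjoint (W.op 1)).ker

instance jointWanderingSpace.completeSpace (W : BiIsometry K) :
    CompleteSpace W.jointWanderingSpace :=
  ((adjoint (W.op 0)).isClosed_ker.inter (adjoint (W.op 1)).isClosed_ker).completeSpace_coe

/-- The isometry `W_0^m W_1^n` from the joint wandering subspace to the whole space. -/
noncomputable def monomialIsometry (W : BiIsometry K) (p : ℕ × ℕ) : W.jointWanderingSpace →ₗᵢ[ℂ] K where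
  toLinearMap := ((W.op 0 ^ p.1 * W.op 1 ^ p.2 : K →L[ℂ] K) : K →ₗ[ℂ] K) ∘ₗ
    W.jointWanderingSpace.subtype
  norm_map' _ := (norm_pow_apply_of_norm_map (W.norm_map 0) _ _).trans
    (norm_pow_apply_of_norm_map (W.norm_map 1) _ _)

theorem monomialIsometry_apply (W : BiIsometry K) (p : ℕ × ℕ) (x : W.jointWanderingSpace) :
    W.monomialIsometry p x = (W.op 0 ^ p.1) ((W.op 1 ^ p.2) x) :=
  rfl

theorem op_monomialIsometry (W : BiIsometry K) (i : Fin 2) (p : ℕ × ℕ)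
    (x : W.jointWanderingSpace) :
    W.op i (W.monomialIsometry p x) = W.monomialIsometry (HardyBidisk.raise i p) x := by
  fin_cases i
  · change W.op 0 ((W.op 0 ^ p.1) ((W.op 1 ^ p.2) x)) = (W.op 0 ^ (p.1 + 1)) ((W.op 1 ^ p.2) x)
    rw [pow_succ', mul_apply_eq_comp]
  · change W.op 1 ((W.op 0 ^ p.1) ((W.op 1 ^ p.2) x)) = (W.op 0 ^ p.1) ((W.op 1 ^ (p.2 + 1)) x)
    rw [comm_pow, pow_succ', mul_apply_eq_comp]

/-- Double commutation keeps `W_1^n L` inside `ker W_0*`, so different powers of `W_0` give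
orthogonal vectors; equal powers cancel and leave the same argument for `W_1`. -/
theorem DoublyCommuting.orthogonalFamily (h : W.DoublyCommuting) :
    OrthogonalFamily ℂ (fun _ : ℕ × ℕ => W.jointWanderingSpace) W.monomialIsometry := by
  rintro ⟨m, n⟩ ⟨m', n'⟩ hne x y
  have hker : ∀ (k : ℕ) (u : W.jointWanderingSpace), (adjoint (W.op 0)) ((W.op 1 ^ k) u) = 0 := by
    intro k u
    rw [← h.op_pow_adjoint (by decide), show (adjoint (W.op 0)) (u : K) = 0 from u.2.1, map_zero]
  simp only [monomialIsometry_apply]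
  by_cases hm : m = m'
  · subst hm
    rw [inner_pow_apply_of_norm_map (W.norm_map 0)]
    exact inner_pow_pow_eq_zero (W.norm_map 1) (by rintro rfl; exact hne rfl) x.2.2 y.2.2
  · exact inner_pow_pow_eq_zero (W.norm_map 0) hm (hker n x) (hker n' y)

/-- Totality comes from using the shift property twice. If `x` is orthogonal to every `W_0^m W_1^n
L`, totality for `W_1` shows that `W_0*^m x` has no component in `ker W_0*`; totality for `W_0` then
gives `x = 0`. -/
theorem DoublyCommuting.isHilbertSum (h : W.DoublyCommuting) (h0 : W.IsPure {0})
    (h1 : W.IsPure {1}) :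
    IsHilbertSum ℂ (fun _ : ℕ × ℕ => W.jointWanderingSpace) W.monomialIsometry := by
  refine IsHilbertSum.mk h.orthogonalFamily ?_
  rw [top_le_iff, Submodule.topologicalClosure_eq_top_iff, Submodule.eq_bot_iff]
  intro x hx
  have hx' : ∀ (m n : ℕ) (f : W.jointWanderingSpace),
      ⟪(W.op 0 ^ m) ((W.op 1 ^ n) (f : K)), x⟫_ℂ = 0 := fun m n f =>
    (Submodule.mem_orthogonal _ _).mp hx _ (Submodule.mem_iSup_of_mem (m, n) ⟨f, rfl⟩)
  refine h.eq_zero_of_orthogonal h0 fun m w hw => ?_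
  set g : K := (adjoint (W.op 0) ^ m) x with hg
  -- The projection `1 - W_0 W_0*` onto `ker W_0*` is self-adjoint.
  have hproj : ∀ u v : K, ⟪u, v - W.op 0 (adjoint (W.op 0) v)⟫_ℂ = ⟪u - W.op 0 (adjoint (W.op 0) u), v⟫_ℂ := by
    intro u v
    rw [inner_sub_left, inner_sub_right, ← ContinuousLinearMap.adjoint_inner_left,
      ContinuousLinearMap.adjoint_inner_right]
  have hy : g - W.op 0 (adjoint (W.op 0) g) = 0 := by
    refine h.eq_zero_of_orthogonal h1 fun n v hv => ?_
    -- This projection commutes with `W_1` and maps `ker W_1*` into the joint wandering space, where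
    -- the orthogonality of `x` applies.
    have hmem : v - W.op 0 (adjoint (W.op 0) v) ∈ W.jointWanderingSpace := by
      refine ⟨?_, ?_⟩
      · change (adjoint (W.op 0)) (v - W.op 0 (adjoint (W.op 0) v)) = 0
        rw [map_sub, adjoint_op_op, sub_self]
      · change (adjoint (W.op 1)) (v - W.op 0 (adjoint (W.op 0) v)) = 0
        rw [map_sub, hv, ← h.op_adjoint (by decide)]
        have hv0 : (adjoint (W.op 1)) (adjoint (W.op 0) v) = 0 := W.adjoint_mem_ker (x := v) hv
        rw [hv0, map_zero, sub_zero]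
    have := hx' m n ⟨_, hmem⟩
    rw [hproj, ← h.op_pow_adjoint (by decide), comm_pow, ← map_sub, hg, inner_adjoint_pow_right]
    exact this
  have := hproj w g
  rw [hy, inner_zero_right, hw, map_zero, sub_zero, hg, inner_adjoint_pow_right] at this
  exact this.symm

end

/-! ### Unitary equivalence with the Hardy space model -/

theorem DoublyCommuting.unitarilyEquivalent {K : Type*} [NormedAddCommGroup K]
    [InnerProductSpace ℂ K] [CompleteSpace K] {W : BiIsometry K} (h : W.DoublyCommuting)
    (h0 : W.IsPure {0}) (h1 : W.IsPure {1}) :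
    W.UnitarilyEquivalent (HardyBidisk.coordBiIsometry W.jointWanderingSpace) := by
  have hV := h.isHilbertSum h0 h1
  -- Intertwining is checked on the inverse map, which sends `f` to the sum of `W_0^m W_1^n
  -- f_{m,n}`: applying `W_i` only reindexes this sum along `raise i`.
  have key : ∀ i (f : HardyBidisk W.jointWanderingSpace),
      hV.linearIsometryEquiv.symm (HardyBidisk.mulCoord i f) =
        W.op i (hV.linearIsometryEquiv.symm f) := by
    intro i f
    refine (hV.hasSum_linearIsometryEquiv_symm _).unique ?_
    rw [← (HardyBidisk.raise_injective i).hasSum_iff]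
    · refine ((W.op i).hasSum (hV.hasSum_linearIsometryEquiv_symm f)).congr_fun fun p => ?_
      simp only [Function.comp, HardyBidisk.mulCoord_raise, op_monomialIsometry]
    · intro p hp
      rw [HardyBidisk.mulCoord_of_not_range i f p (fun ⟨q, hq⟩ => hp ⟨q, hq⟩), map_zero]
  refine ⟨hV.linearIsometryEquiv, fun i x => ?_⟩
  have := key i (hV.linearIsometryEquiv x)
  rw [LinearIsometryEquiv.symm_apply_apply] at this
  rw [← this, LinearIsometryEquiv.apply_symm_apply]
  rfl

theorem UnitarilyEquivalent.doublyCommuting {K K' : Type*} [NormedAddCommGroup K]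
    [InnerProductSpace ℂ K] [CompleteSpace K] [NormedAddCommGroup K'] [InnerProductSpace ℂ K']
    [CompleteSpace K'] {W : BiIsometry K} {W' : BiIsometry K'} (hW : W.UnitarilyEquivalent W')
    (h : W'.DoublyCommuting) : W.DoublyCommuting := by
  obtain ⟨U, hU⟩ := hW
  have hadj : ∀ i x, U ((adjoint (W.op i)) x) = (adjoint (W'.op i)) (U x) := by
    intro i x
    refine ext_inner_right ℂ fun y => ?_
    obtain ⟨y, rfl⟩ := U.surjective y
    rw [ContinuousLinearMap.adjoint_inner_left, ← hU, U.inner_map_map, U.inner_map_map,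
      ContinuousLinearMap.adjoint_inner_left]
  rw [doublyCommuting_iff] at h ⊢
  intro x hx
  apply U.injective
  rw [map_zero, hadj, hU]
  exact h _ (by rw [← hadj, hx, map_zero])

end BiIsometry

/-! ### Double commutation of the coordinate multiplications -/

namespace HardyBidisk

theorem mulCoord_single {F : Type*} [NormedAddCommGroup F] [InnerProductSpace ℂ F] (i : Fin 2)
    (p : ℕ × ℕ) (a : F) :
    mulCoord i (lp.single 2 p a : HardyBidisk F) = lp.single 2 (raise i p) a := by
  ext q
  by_cases hq : ∃ r, raise i r = q
  · obtain ⟨r, rfl⟩ := hq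
    rw [mulCoord_raise, lp.coeFn_single, lp.coeFn_single]
    simp only [Pi.single_apply, (raise_injective i).eq_iff]
  · rw [mulCoord_of_not_range i _ _ hq, lp.coeFn_single, Pi.single_eq_of_ne]
    rintro rfl
    exact hq ⟨p, rfl⟩

/-- Pairing with one-coefficient series reads off coefficients, and multiplication by `z_i` moves
such a series along `raise i`. -/
theorem adjoint_mulCoord_apply {F : Type*} [NormedAddCommGroup F] [InnerProductSpace ℂ F]
    [CompleteSpace F] (i : Fin 2) (f : HardyBidisk F) (p : ℕ × ℕ) :
    (adjoint ((coordBiIsometry F).op i)) f p = f (raise i p) := by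
  refine ext_inner_right ℂ fun a => ?_
  rw [← lp.inner_single_right, ContinuousLinearMap.adjoint_inner_left]
  change ⟪f, mulCoord i (lp.single 2 p a)⟫_ℂ = _
  rw [mulCoord_single, lp.inner_single_right]

theorem doublyCommuting_coordBiIsometry (F : Type*) [NormedAddCommGroup F]
    [InnerProductSpace ℂ F] [CompleteSpace F] : (coordBiIsometry F).DoublyCommuting := by
  refine ContinuousLinearMap.ext fun f => ?_
  ext ⟨m, n⟩
  change mulCoord 0 ((adjoint ((coordBiIsometry F).op 1)) f) (m, n) =
    (adjoint ((coordBiIsometry F).op 1)) (mulCoord 0 f) (m, n)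
  rw [adjoint_mulCoord_apply]
  cases m with
  | zero =>
    rw [mulCoord_of_not_range 0 _ _ (by simp [raise]), mulCoord_of_not_range 0 _ _ (by simp [raise])]
  | succ m =>
    rw [show (m + 1, n) = raise 0 (m, n) from rfl, mulCoord_raise, adjoint_mulCoord_apply,
      show raise 1 (raise 0 (m, n)) = raise 0 (raise 1 (m, n)) from rfl, mulCoord_raise]

end HardyBidisk

theorem proposition6p3 {K : Type u} [NormedAddCommGroup K] [InnerProductSpace ℂ K]
    [CompleteSpace K] (W : BiIsometry K) (h0 : W.IsPure {0}) (h1 : W.IsPure {1}) :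
    List.TFAE [
      ∃ (F : Type u) (_ : NormedAddCommGroup F) (_ : InnerProductSpace ℂ F)
        (_ : CompleteSpace F), W.UnitarilyEquivalent (HardyBidisk.coordBiIsometry F),
      W.DoublyCommuting,
      W.CharFunctionIsConstantIsometry,
      Isometry W.swap.pivotalOperator,
      Isometry W.pivotalOperator] := by
  tfae_have 1 → 2 := by
    rintro ⟨F, _, _, _, hF⟩
    exact hF.doublyCommuting (HardyBidisk.doublyCommuting_coordBiIsometry F)
  tfae_have 2 → 1 := fun h =>
    ⟨W.jointWanderingSpace, inferInstance, inferInstance, inferInstance,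
      h.unitarilyEquivalent h0 h1⟩
  tfae_have 3 ↔ 4 := by
    rw [BiIsometry.charFunctionIsConstantIsometry_iff, BiIsometry.isometry_pivotalOperator_iff,
      BiIsometry.doublyCommuting_iff]
    -- Both sides state that `W_1` maps `ker W_0*` into itself.
    rfl
  tfae_have 4 ↔ 2 :=
    BiIsometry.isometry_pivotalOperator_iff.trans BiIsometry.doublyCommuting_swap_iff
  tfae_have 5 ↔ 2 := BiIsometry.isometry_pivotalOperator_iff
  tfae_finish
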